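/- Let $\mathbb E^n_t$ be $\mathbb R^n$ with an indefinite inner product $\langle\cdot,\cdot\rangle$ of index $t$ (that is, $t$ minus signs in diagonal form), and let $\mathbb S^4_2(1)=\{v\in\mathbb E^5_2:\langle v,v\rangle=1\}$ and $\mathbb S^2_1(\tfrac13)=\{p\in\mathbb E^3_1:\langle p,p\rangle=3\}$. Let $I\subseteq\mathbb R$ be an open interval and let $\alpha:I\to\mathbb E^5_2$ be a smooth null curve in the light cone, that is, $\langle\alpha,\alpha\rangle=\langle\alpha',\alpha'\rangle=0$, such that $\langle\alpha'',\alpha''\rangle=\tfrac49$ on $I$. Put $\eta=\langle\alpha''',\alpha'''\rangle$ and $\xi=\langle\alpha^{(4)},\alpha^{(4)}\rangle$, and let $M$ be the surface $$x(s,t)=\Big(\tfrac12 s^2+\tfrac{27}{40}\,\eta(t)\Big)\alpha(t)+\tfrac32\,s\,\alpha'(t)+\tfrac32\,\alpha''(t),\qquad (s,t)\in\mathbb R\times I.$$ If $$\tfrac{27}{40}\,\eta''-\tfrac{5103}{1600}\,\eta^2+\tfrac{27}{16}\,\xi=0\quad\text{on } I,$$ then $M$ is congruent to an open part of the Lorentzian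 Veronese surface, i.e. of the immersion $V:\mathbb S^2_1(\tfrac13)=\{x^2+y^2-z^2=3\}\to\mathbb S^4_2(1)$, $$V(x,y,z)=\Big(\tfrac{xz}{\sqrt3},\tfrac{yz}{\sqrt3},\tfrac{x^2+y^2+2z^2}{6},\tfrac{x^2-y^2}{2\sqrt3},\tfrac{xy}{\sqrt3}\Big),$$ where the first two coordinates of $\mathbb E^5_2$ are the timelike ones. Precisely: there are a linear isometry $A$ of $\mathbb E^5_2$ and a smooth local isometry $\psi$ from $\mathbb R\times I$, with the metric induced by $x$, onto an open subset of $\mathbb S^2_1(\tfrac13)$ such that $A\circ x=V\circ\psi$. -/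

import Mathlib

open Set
open scoped ContDiff

noncomputable section

/-- The indefinite inner product of index `t` on `ℝⁿ`: the first `t` coordinates are timelike. With
this form `Fin n → ℝ` is the pseudo-Euclidean space `𝔼ⁿ_t`. -/
def pseudoInner (t : ℕ) {n : ℕ} (v w : Fin n → ℝ) : ℝ :=
  ∑ i : Fin n, (if (i : ℕ) < t then (-1 : ℝ) else 1) * v i * w i

/-- The pseudo-sphere of index `t` and constant curvature `c > 0` in `𝔼ⁿ_t` (it has dimension
`n - 1`): the vectors with `⟨v, v⟩ = 1 / c`. -/
def pseudoSphere (n t : ℕ) (c : ℝ) : Set (Fin n → ℝ) :=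
  {v | pseudoInner t v v = c⁻¹}

/-- The light cone of `𝔼ⁿ_t`. -/
def lightCone (n t : ℕ) : Set (Fin n → ℝ) :=
  {v | pseudoInner t v v = 0}

/-- `η = ⟨α''', α'''⟩` for a curve `α` in `𝔼⁵_2`. -/
def etaFun (α : ℝ → Fin 5 → ℝ) (t : ℝ) : ℝ :=
  pseudoInner 2 (iteratedDeriv 3 α t) (iteratedDeriv 3 α t)

/-- `ξ = ⟨α⁗, α⁗⟩` (fourth derivatives) for a curve `α` in `𝔼⁵_2`. -/
def xiFun (α : ℝ → Fin 5 → ℝ) (t : ℝ) : ℝ :=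
  pseudoInner 2 (iteratedDeriv 4 α t) (iteratedDeriv 4 α t)

/-- The surface generated by `α`:
`x(s, t) = (s² / 2 + (27 / 40) ⟨α''', α'''⟩) α + (3 / 2) s α' + (3 / 2) α''`. -/
def surfaceOf (α : ℝ → Fin 5 → ℝ) (p : ℝ × ℝ) : Fin 5 → ℝ :=
  (p.1 ^ 2 / 2 + 27 / 40 * etaFun α p.2) • α p.2 + (3 / 2 * p.1) • deriv α p.2
    + (3 / 2 : ℝ) • iteratedDeriv 2 α p.2

/-- The quadratic map whose restriction to `𝕊²₁(1/3) = pseudoSphere 3 1 (1 / 3)` is the Lorentzian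
Veronese surface in `𝕊⁴₂(1) = pseudoSphere 5 2 1`. The coordinates of the source are
`(p 0, p 1, p 2) = (z, x, y)` with `z` timelike; in the target the two timelike coordinates
`x z / √3` and `y z / √3` come first. -/
def lorentzVeronese (p : Fin 3 → ℝ) : Fin 5 → ℝ :=
  ![p 1 * p 0 / √3,
    p 2 * p 0 / √3,
    (p 1 ^ 2 + p 2 ^ 2 + 2 * p 0 ^ 2) / 6,
    (p 1 ^ 2 - p 2 ^ 2) / (2 * √3),
    p 1 * p 2 / √3]

/-- The immersed surface `x : D → 𝔼⁵_2` (`D` an open set of parameters) is congruent to (an open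
part of) the Lorentzian Veronese surface: after a linear isometry `A` of `𝔼⁵_2` (that is, a rigid
motion of `𝕊⁴₂(1)`) it is the Veronese immersion precomposed with a smooth local isometry `ψ` from
`D`, with the metric induced by `x`, onto an open part of `𝕊²₁(1/3)`. -/
def IsCongruentToLorentzVeronese (D : Set (ℝ × ℝ)) (x : ℝ × ℝ → Fin 5 → ℝ) : Prop :=
  ∃ (A : (Fin 5 → ℝ) ≃ₗ[ℝ] (Fin 5 → ℝ)) (ψ : ℝ × ℝ → Fin 3 → ℝ) (O : Set (Fin 3 → ℝ)),
    (∀ v w, pseudoInner 2 (A v) (A w) = pseudoInner 2 v w) ∧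
    ContDiffOn ℝ ∞ ψ D ∧
    (∀ p ∈ D, ∀ v w : ℝ × ℝ,
      pseudoInner 1 (fderiv ℝ ψ p v) (fderiv ℝ ψ p w)
        = pseudoInner 2 (fderiv ℝ x p v) (fderiv ℝ x p w)) ∧
    IsOpen O ∧ ψ '' D = pseudoSphere 3 1 (1 / 3) ∩ O ∧
    ∀ p ∈ D, A (x p) = lorentzVeronese (ψ p)

end

/-! ### Bilinearity, nondegeneracy and differentiation of the indefinite inner product. -/

section PseudoInner

variable {n : ℕ} (k : ℕ)

/-! Up to scale, the apolar pairing of binary quartics is a form of index 2, so 𝔼⁵₂ becomes the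
irreducible five-dimensional representation of SL(2, ℝ). Fourth powers lie on the cone over the
rational normal curve, which is the Veronese image of the light cone of 𝔼³₁.

The Gram matrix of `α, α', ..., α⁗` involves only η, ξ and η'. The differential equation is what
lets a triangular change of this frame be null with structure equations in the irreducible so(2, 1)
(`exists_nullFrame`). The catalecticant of quartics is invariant under this algebra, so its value at
a fixed vector is the same in every frame along the curve. In its own frame `α t` is twice a fourth
power, a singular point of the catalecticant; hence it is also singular in the frame at `t₀`. With
nullity this puts `α` on the rational normal cone, and a square root gives a null curve β with A α =
2 V(β) (`exists_null_lift`).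

Differentiation gives ⟨β', β'⟩ = 1/3 and η = 20/3 ⟨β'', β''⟩ (`null_lift_triple`). Since V has
harmonic components, the formula for `x` collapses to V(s β + 3 β') (`isometry_surfaceOf_eq`). The
map s β + 3 β' is a local isometry because V is isometric on the sphere (`pseudoInner_fderiv_eq`),
and its image is relatively open because β, β', β'' form a basis (`isOpen_cone_ruledMap`). -/

lemma pseudoInner_comm (v w : Fin n → ℝ) : pseudoInner k v w = pseudoInner k w v := by
  simp only [pseudoInner]
  exact Finset.sum_congr rfl fun i _ => by ring

lemma pseudoInner_add_left (u v w : Fin n → ℝ) :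
    pseudoInner k (u + v) w = pseudoInner k u w + pseudoInner k v w := by
  simp only [pseudoInner, ← Finset.sum_add_distrib, Pi.add_apply]
  exact Finset.sum_congr rfl fun i _ => by ring

lemma pseudoInner_smul_left (c : ℝ) (v w : Fin n → ℝ) :
    pseudoInner k (c • v) w = c * pseudoInner k v w := by
  simp only [pseudoInner, Finset.mul_sum, Pi.smul_apply, smul_eq_mul]
  exact Finset.sum_congr rfl fun i _ => by ring

lemma pseudoInner_add_right (u v w : Fin n → ℝ) :
    pseudoInner k w (u + v) = pseudoInner k w u + pseudoInner k w v := by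
  rw [pseudoInner_comm, pseudoInner_add_left, pseudoInner_comm k u, pseudoInner_comm k v]

lemma pseudoInner_smul_right (c : ℝ) (v w : Fin n → ℝ) :
    pseudoInner k w (c • v) = c * pseudoInner k w v := by
  rw [pseudoInner_comm, pseudoInner_smul_left, pseudoInner_comm k v]

lemma eq_zero_of_pseudoInner_eq_zero (v : Fin n → ℝ) (h : ∀ w, pseudoInner k v w = 0) :
    v = 0 := by
  funext i
  have := h (Pi.single i 1)
  simp only [pseudoInner, Pi.single_apply, mul_ite, mul_one, mul_zero, Finset.sum_ite_eq',
    Finset.mem_univ, if_true] at this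
  split_ifs at this with h <;> simpa using this

lemma pseudoInner_five (v w : Fin 5 → ℝ) : pseudoInner 2 v w =
    -(v 0 * w 0) - v 1 * w 1 + v 2 * w 2 + v 3 * w 3 + v 4 * w 4 := by
  simp [pseudoInner, Fin.sum_univ_five]
  ring

lemma pseudoInner_three (v w : Fin 3 → ℝ) : pseudoInner 1 v w =
    -(v 0 * w 0) + v 1 * w 1 + v 2 * w 2 := by
  simp [pseudoInner, Fin.sum_univ_three]

lemma HasDerivAt.pseudoInner {f g : ℝ → Fin n → ℝ} {f' g' : Fin n → ℝ} {t : ℝ}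
    (hf : HasDerivAt f f' t) (hg : HasDerivAt g g' t) :
    HasDerivAt (fun s => pseudoInner k (f s) (g s))
      (pseudoInner k f' (g t) + pseudoInner k (f t) g') t := by
  rw [hasDerivAt_pi] at hf hg
  unfold _root_.pseudoInner
  rw [← Finset.sum_add_distrib]
  exact HasDerivAt.fun_sum fun i _ => ((hf i).const_mul _).mul (hg i)

lemma ContDiffOn.pseudoInner {f g : ℝ → Fin n → ℝ} {I : Set ℝ}
    (hf : ContDiffOn ℝ ∞ f I) (hg : ContDiffOn ℝ ∞ g I) :
    ContDiffOn ℝ ∞ (fun s => pseudoInner k (f s) (g s)) I := by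
  rw [contDiffOn_pi] at hf hg
  unfold _root_.pseudoInner
  exact ContDiffOn.sum fun i _ => (contDiffOn_const.mul (hf i)).mul (hg i)

end PseudoInner

/-! ### Derivatives of smooth curves on an open set. -/

section Calculus

variable {E : Type*} [NormedAddCommGroup E] [NormedSpace ℝ E] {I : Set ℝ}

lemma HasDerivAt.eq_of_eqOn (hI : IsOpen I) {f g : ℝ → E} {f' g' : E} {t : ℝ} (ht : t ∈ I)
    (hfg : ∀ s ∈ I, f s = g s) (hf : HasDerivAt f f' t) (hg : HasDerivAt g g' t) : f' = g' :=
  hf.unique (hg.congr_of_eventuallyEq (Filter.eventually_of_mem (hI.mem_nhds ht) hfg))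

lemma ContDiffOn.hasDerivAt_deriv (hI : IsOpen I) {f : ℝ → E} (hf : ContDiffOn ℝ ∞ f I)
    {t : ℝ} (ht : t ∈ I) : HasDerivAt f (deriv f t) t :=
  ((hf.contDiffAt (hI.mem_nhds ht)).differentiableAt (by simp)).hasDerivAt

lemma ContDiffOn.iteratedDeriv_of_isOpen (hI : IsOpen I) {f : ℝ → E} (hf : ContDiffOn ℝ ∞ f I)
    (m : ℕ) : ContDiffOn ℝ ∞ (iteratedDeriv m f) I := by
  induction m with
  | zero => simpa using hf
  | succ m ih => rw [iteratedDeriv_succ]; exact ih.deriv_of_isOpen hI (by simp)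

lemma ContDiffOn.hasDerivAt_iteratedDeriv (hI : IsOpen I) {f : ℝ → E}
    (hf : ContDiffOn ℝ ∞ f I) (m : ℕ) {t : ℝ} (ht : t ∈ I) :
    HasDerivAt (iteratedDeriv m f) (iteratedDeriv (m + 1) f t) t := by
  rw [iteratedDeriv_succ]
  exact (hf.iteratedDeriv_of_isOpen hI m).hasDerivAt_deriv hI ht

end Calculus

/-! ### Null frames and the normalised osculating frame. -/

/-- A basis of `𝔼⁵_2` with the Gram matrix of the osculating null frame of a null curve. -/
structure IsNullFrame (X₀ X₁ X₂ X₃ X₄ : Fin 5 → ℝ) : Prop where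
  h00 : pseudoInner 2 X₀ X₀ = 0
  h01 : pseudoInner 2 X₀ X₁ = 0
  h02 : pseudoInner 2 X₀ X₂ = 0
  h03 : pseudoInner 2 X₀ X₃ = 0
  h04 : pseudoInner 2 X₀ X₄ = 4 / 9
  h11 : pseudoInner 2 X₁ X₁ = 0
  h12 : pseudoInner 2 X₁ X₂ = 0
  h13 : pseudoInner 2 X₁ X₃ = -4 / 9
  h14 : pseudoInner 2 X₁ X₄ = 0
  h22 : pseudoInner 2 X₂ X₂ = 4 / 9
  h23 : pseudoInner 2 X₂ X₃ = 0
  h24 : pseudoInner 2 X₂ X₄ = 0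
  h33 : pseudoInner 2 X₃ X₃ = 0
  h34 : pseudoInner 2 X₃ X₄ = 0
  h44 : pseudoInner 2 X₄ X₄ = 0

namespace IsNullFrame

variable {X₀ X₁ X₂ X₃ X₄ : Fin 5 → ℝ}

/-- The Gram matrix is antidiagonal with entries ±4/9, so pairing with the dual vectors recovers
coefficients. This gives injectivity of the coefficient map, and dimension gives surjectivity. -/
lemma expansion (h : IsNullFrame X₀ X₁ X₂ X₃ X₄) (v : Fin 5 → ℝ) :
    v = (9 / 4 * pseudoInner 2 v X₄) • X₀ + (-(9 / 4) * pseudoInner 2 v X₃) • X₁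
      + (9 / 4 * pseudoInner 2 v X₂) • X₂ + (-(9 / 4) * pseudoInner 2 v X₁) • X₃
      + (9 / 4 * pseudoInner 2 v X₀) • X₄ := by
  let L : (Fin 5 → ℝ) →ₗ[ℝ] (Fin 5 → ℝ) :=
    (LinearMap.proj 0).smulRight X₀ + (LinearMap.proj 1).smulRight X₁
      + (LinearMap.proj 2).smulRight X₂ + (LinearMap.proj 3).smulRight X₃
      + (LinearMap.proj 4).smulRight X₄
  have hL (a : Fin 5 → ℝ) :
      L a = a 0 • X₀ + a 1 • X₁ + a 2 • X₂ + a 3 • X₃ + a 4 • X₄ := rfl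
  have key (a : Fin 5 → ℝ) : 9 / 4 * pseudoInner 2 (L a) X₄ = a 0 ∧
      -(9 / 4) * pseudoInner 2 (L a) X₃ = a 1 ∧ 9 / 4 * pseudoInner 2 (L a) X₂ = a 2 ∧
      -(9 / 4) * pseudoInner 2 (L a) X₁ = a 3 ∧ 9 / 4 * pseudoInner 2 (L a) X₀ = a 4 := by
    simp only [hL, pseudoInner_add_left, pseudoInner_smul_left, h.h00, h.h01, h.h02, h.h03, h.h04,
      h.h11, h.h12, h.h13, h.h14, h.h22, h.h23, h.h24, h.h33, h.h34, h.h44,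
      pseudoInner_comm 2 X₁ X₀, pseudoInner_comm 2 X₂ X₀, pseudoInner_comm 2 X₃ X₀,
      pseudoInner_comm 2 X₄ X₀, pseudoInner_comm 2 X₂ X₁, pseudoInner_comm 2 X₃ X₁,
      pseudoInner_comm 2 X₄ X₁, pseudoInner_comm 2 X₃ X₂, pseudoInner_comm 2 X₄ X₂,
      pseudoInner_comm 2 X₄ X₃]
    refine ⟨?_, ?_, ?_, ?_, ?_⟩ <;> ring
  have hinj : Function.Injective L := by
    intro a b hab
    obtain ⟨a0, a1, a2, a3, a4⟩ := key a
    obtain ⟨b0, b1, b2, b3, b4⟩ := key b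
    rw [hab] at a0 a1 a2 a3 a4
    funext i
    fin_cases i
    exacts [a0.symm.trans b0, a1.symm.trans b1, a2.symm.trans b2, a3.symm.trans b3,
      a4.symm.trans b4]
  obtain ⟨a, rfl⟩ := LinearMap.injective_iff_surjective.1 hinj v
  obtain ⟨a0, a1, a2, a3, a4⟩ := key a
  rw [a0, a1, a2, a3, a4, ← hL]

lemma pseudoInner_eq (h : IsNullFrame X₀ X₁ X₂ X₃ X₄) (v w : Fin 5 → ℝ) :
    pseudoInner 2 v w = 9 / 4 *
      (pseudoInner 2 v X₄ * pseudoInner 2 w X₀ - pseudoInner 2 v X₃ * pseudoInner 2 w X₁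
        + pseudoInner 2 v X₂ * pseudoInner 2 w X₂ - pseudoInner 2 v X₁ * pseudoInner 2 w X₃
        + pseudoInner 2 v X₀ * pseudoInner 2 w X₄) := by
  conv_lhs => rw [pseudoInner_comm, h.expansion v]
  simp only [pseudoInner_add_right, pseudoInner_smul_right]
  ring

lemma eq_zero (h : IsNullFrame X₀ X₁ X₂ X₃ X₄) {v : Fin 5 → ℝ}
    (h0 : pseudoInner 2 v X₀ = 0) (h1 : pseudoInner 2 v X₁ = 0) (h2 : pseudoInner 2 v X₂ = 0)
    (h3 : pseudoInner 2 v X₃ = 0) (h4 : pseudoInner 2 v X₄ = 0) : v = 0 := by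
  rw [h.expansion v, h0, h1, h2, h3, h4]
  simp

end IsNullFrame

/-- The osculating frame of a null curve can be normalised so that its structure equations take
values in the irreducible copy of `so(2, 1)` in `so(3, 2)`. -/
lemma exists_nullFrame {I : Set ℝ} (hI : IsOpen I)
    {α : ℝ → Fin 5 → ℝ} (hα : ContDiffOn ℝ ∞ α I)
    (hcone : ∀ t ∈ I, α t ∈ lightCone 5 2)
    (hnull : ∀ t ∈ I, pseudoInner 2 (deriv α t) (deriv α t) = 0)
    (hnorm : ∀ t ∈ I, pseudoInner 2 (iteratedDeriv 2 α t) (iteratedDeriv 2 α t) = 4 / 9)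
    (hode : ∀ t ∈ I, 27 / 40 * iteratedDeriv 2 (etaFun α) t - 5103 / 1600 * etaFun α t ^ 2
      + 27 / 16 * xiFun α t = 0) :
    ∃ (X₁ X₂ X₃ X₄ : ℝ → Fin 5 → ℝ) (κ : ℝ → ℝ), ∀ t ∈ I,
      IsNullFrame (α t) (X₁ t) (X₂ t) (X₃ t) (X₄ t) ∧
      HasDerivAt α (X₁ t) t ∧
      HasDerivAt X₁ (X₂ t - (3 * κ t) • α t) t ∧
      HasDerivAt X₂ (X₃ t - (9 / 2 * κ t) • X₁ t) t ∧
      HasDerivAt X₃ (X₄ t - (9 / 2 * κ t) • X₂ t) t ∧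
      HasDerivAt X₄ (-(3 * κ t) • X₃ t) t := by
  set a : ℕ → ℝ → Fin 5 → ℝ := fun m => iteratedDeriv m α with ha
  have hd (m : ℕ) {t : ℝ} (ht : t ∈ I) : HasDerivAt (a m) (a (m + 1) t) t :=
    hα.hasDerivAt_iteratedDeriv hI m ht
  have hd0 {t : ℝ} (ht : t ∈ I) : HasDerivAt α (a 1 t) t := by
    simpa [ha] using hd 0 ht
  have next (i j : ℕ) (f : ℝ → ℝ) (hf : ∀ t ∈ I, pseudoInner 2 (a i t) (a j t) = f t) {f' t : ℝ}
      (ht : t ∈ I) (hf' : HasDerivAt f f' t) :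
      pseudoInner 2 (a (i + 1) t) (a j t) + pseudoInner 2 (a i t) (a (j + 1) t) = f' :=
    HasDerivAt.eq_of_eqOn hI ht hf ((hd i ht).pseudoInner 2 (hd j ht)) hf'
  have comm (i j : ℕ) (t : ℝ) : pseudoInner 2 (a i t) (a j t) = pseudoInner 2 (a j t) (a i t) :=
    pseudoInner_comm _ _ _
  have g00 : ∀ t ∈ I, pseudoInner 2 (a 0 t) (a 0 t) = 0 := fun t ht => by
    simpa [ha, lightCone] using hcone t ht
  have g11 : ∀ t ∈ I, pseudoInner 2 (a 1 t) (a 1 t) = 0 := fun t ht => by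
    simpa [ha, iteratedDeriv_one] using hnull t ht
  have g22 : ∀ t ∈ I, pseudoInner 2 (a 2 t) (a 2 t) = 4 / 9 := hnorm
  set η := etaFun α with hη
  have g33 : ∀ t ∈ I, pseudoInner 2 (a 3 t) (a 3 t) = η t := fun t _ => rfl
  have g01 : ∀ t ∈ I, pseudoInner 2 (a 0 t) (a 1 t) = 0 := fun t ht => by
    have := next 0 0 _ g00 ht (hasDerivAt_const t 0)
    linarith [comm 0 1 t]
  have g12 : ∀ t ∈ I, pseudoInner 2 (a 1 t) (a 2 t) = 0 := fun t ht => by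
    have := next 1 1 _ g11 ht (hasDerivAt_const t 0)
    linarith [comm 1 2 t]
  have g23 : ∀ t ∈ I, pseudoInner 2 (a 2 t) (a 3 t) = 0 := fun t ht => by
    have := next 2 2 _ g22 ht (hasDerivAt_const t _)
    linarith [comm 2 3 t]
  have hηs : ContDiffOn ℝ ∞ η I :=
    (hα.iteratedDeriv_of_isOpen hI 3).pseudoInner 2 (hα.iteratedDeriv_of_isOpen hI 3)
  have hη0 {t : ℝ} (ht : t ∈ I) : HasDerivAt η (deriv η t) t := hηs.hasDerivAt_deriv hI ht
  have hη1 {t : ℝ} (ht : t ∈ I) : HasDerivAt (deriv η) (iteratedDeriv 2 η t) t := by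
    simpa [iteratedDeriv_one] using hηs.hasDerivAt_iteratedDeriv hI 1 ht
  have hη2 {t : ℝ} (ht : t ∈ I) : HasDerivAt (iteratedDeriv 2 η) (iteratedDeriv 3 η t) t :=
    hηs.hasDerivAt_iteratedDeriv hI 2 ht
  have g34 : ∀ t ∈ I, pseudoInner 2 (a 3 t) (a 4 t) = deriv η t / 2 := fun t ht => by
    have := next 3 3 _ g33 ht (hη0 ht)
    linarith [comm 3 4 t]
  have g02 : ∀ t ∈ I, pseudoInner 2 (a 0 t) (a 2 t) = 0 := fun t ht => by
    have := next 0 1 _ g01 ht (hasDerivAt_const t _)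
    linarith [g11 t ht]
  have g03 : ∀ t ∈ I, pseudoInner 2 (a 0 t) (a 3 t) = 0 := fun t ht => by
    have := next 0 2 _ g02 ht (hasDerivAt_const t _)
    linarith [g12 t ht]
  have g13 : ∀ t ∈ I, pseudoInner 2 (a 1 t) (a 3 t) = -4 / 9 := fun t ht => by
    have := next 1 2 _ g12 ht (hasDerivAt_const t _)
    linarith [g22 t ht]
  have g04 : ∀ t ∈ I, pseudoInner 2 (a 0 t) (a 4 t) = 4 / 9 := fun t ht => by
    have := next 0 3 _ g03 ht (hasDerivAt_const t _)
    linarith [g13 t ht]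
  have g14 : ∀ t ∈ I, pseudoInner 2 (a 1 t) (a 4 t) = 0 := fun t ht => by
    have := next 1 3 _ g13 ht (hasDerivAt_const t _)
    linarith [g23 t ht]
  have g24 : ∀ t ∈ I, pseudoInner 2 (a 2 t) (a 4 t) = -η t := fun t ht => by
    have := next 2 3 _ g23 ht (hasDerivAt_const t _)
    linarith [g33 t ht]
  -- The only use of the differential equation: this value of ξ is the one for which X₄ below is
  -- null.
  have g44 : ∀ t ∈ I, pseudoInner 2 (a 4 t) (a 4 t)
      = 189 / 100 * η t ^ 2 - 2 / 5 * iteratedDeriv 2 η t := fun t ht => by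
    have := hode t ht
    simp only [xiFun] at this
    linarith
  -- The factor 3/20 is forced by ⟨X₃, X₃⟩ = η - (20/3) κ = 0. The coefficients of X₂, X₃, X₄ then
  -- follow from the structure equations, whose weights 3, 9/2, 9/2, 3 are proportional to the
  -- weights 4, 6, 6, 4 of so(2, 1) on quartics.
  set κ : ℝ → ℝ := fun t => 3 / 20 * η t with hκ
  set κ₁ : ℝ → ℝ := fun t => 3 / 20 * deriv η t
  set κ₂ : ℝ → ℝ := fun t => 3 / 20 * iteratedDeriv 2 η t
  have dκ {t : ℝ} (ht : t ∈ I) : HasDerivAt κ (κ₁ t) t := (hη0 ht).const_mul _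
  have dκ₁ {t : ℝ} (ht : t ∈ I) : HasDerivAt κ₁ (κ₂ t) t := (hη1 ht).const_mul _
  have dκ₂ {t : ℝ} (ht : t ∈ I) : HasDerivAt κ₂ (3 / 20 * iteratedDeriv 3 η t) t :=
    (hη2 ht).const_mul _
  set X₂ : ℝ → Fin 5 → ℝ := fun t => a 2 t + (3 * κ t) • α t with hX₂
  set X₃ : ℝ → Fin 5 → ℝ := fun t => a 3 t + (15 / 2 * κ t) • a 1 t + (3 * κ₁ t) • α t with hX₃
  set X₄ : ℝ → Fin 5 → ℝ := fun t => a 4 t + (12 * κ t) • a 2 t + (21 / 2 * κ₁ t) • a 1 t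
    + (3 * κ₂ t + 27 / 2 * κ t ^ 2) • α t with hX₄
  have ha0 : α = a 0 := by simp [ha]
  have frame : ∀ t ∈ I, IsNullFrame (α t) (a 1 t) (X₂ t) (X₃ t) (X₄ t) := by
    intro t ht
    constructor <;>
    simp only [hX₂, hX₃, hX₄, ha0, pseudoInner_add_left, pseudoInner_smul_left,
      pseudoInner_add_right, pseudoInner_smul_right, comm 1 0, comm 2 0, comm 2 1, comm 3 0,
      comm 3 1, comm 3 2, comm 4 0, comm 4 1, comm 4 2, g00 t ht, g01 t ht, g02 t ht,
      g03 t ht, g04 t ht, g11 t ht, g12 t ht, g13 t ht, g14 t ht, g22 t ht, g23 t ht, g24 t ht,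
      g33 t ht, g34 t ht, g44 t ht, κ, κ₁, κ₂] <;> ring
  have dX₁ {t : ℝ} (ht : t ∈ I) : HasDerivAt (a 1) (X₂ t - (3 * κ t) • α t) t := by
    convert hd 1 ht using 1
    simp [hX₂]
  have dX₂ {t : ℝ} (ht : t ∈ I) : HasDerivAt X₂ (X₃ t - (9 / 2 * κ t) • a 1 t) t := by
    refine ((hd 2 ht).add (((dκ ht).const_mul 3).smul (hd0 ht))).congr_deriv ?_
    simp only [hX₃]
    module
  have dX₃ {t : ℝ} (ht : t ∈ I) : HasDerivAt X₃ (X₄ t - (9 / 2 * κ t) • X₂ t) t := by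
    refine (((hd 3 ht).add (((dκ ht).const_mul (15 / 2)).smul (hd 1 ht))).add
      (((dκ₁ ht).const_mul 3).smul (hd0 ht))).congr_deriv ?_
    simp only [hX₄, hX₂]
    module
  -- Only existence is needed: differentiating the constant products of X₄ with the frame determines
  -- the pairing of X₄' with every frame vector.
  have dX₄' {t : ℝ} (ht : t ∈ I) : ∃ D, HasDerivAt X₄ D t :=
    ⟨_, (((hd 4 ht).add (((dκ ht).const_mul 12).smul (hd 2 ht))).add
      (((dκ₁ ht).const_mul (21 / 2)).smul (hd 1 ht))).add
      ((((dκ₂ ht).const_mul 3).add (((dκ ht).pow 2).const_mul (27 / 2))).smul (hd0 ht))⟩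
  refine ⟨a 1, X₂, X₃, X₄, κ, fun t ht => ⟨frame t ht, hd0 ht, dX₁ ht, dX₂ ht, dX₃ ht, ?_⟩⟩
  obtain ⟨D, hD⟩ := dX₄' ht
  have F := frame t ht
  have e0 := HasDerivAt.eq_of_eqOn hI ht (fun s hs => (frame s hs).h04)
    ((hd0 ht).pseudoInner 2 hD) (hasDerivAt_const t _)
  have e1 := HasDerivAt.eq_of_eqOn hI ht (fun s hs => (frame s hs).h14)
    ((dX₁ ht).pseudoInner 2 hD) (hasDerivAt_const t _)
  have e2 := HasDerivAt.eq_of_eqOn hI ht (fun s hs => (frame s hs).h24)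
    ((dX₂ ht).pseudoInner 2 hD) (hasDerivAt_const t _)
  have e3 := HasDerivAt.eq_of_eqOn hI ht (fun s hs => (frame s hs).h34)
    ((dX₃ ht).pseudoInner 2 hD) (hasDerivAt_const t _)
  have e4 := HasDerivAt.eq_of_eqOn hI ht (fun s hs => (frame s hs).h44)
    (hD.pseudoInner 2 hD) (hasDerivAt_const t _)
  simp only [sub_eq_add_neg, ← neg_smul, pseudoInner_add_left, pseudoInner_smul_left, F.h04, F.h14,
    F.h24, F.h34, F.h44] at e0 e1 e2 e3 e4
  have hz : D + (3 * κ t) • X₃ t = 0 := by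
    apply F.eq_zero <;> rw [pseudoInner_comm] <;>
      simp only [pseudoInner_add_right, pseudoInner_smul_right, F.h03, F.h13, F.h23, F.h33,
        pseudoInner_comm 2 (X₄ t) (X₃ t), F.h34] <;>
      linarith [pseudoInner_comm 2 D (X₄ t)]
  rw [neg_smul, ← eq_neg_of_add_eq_zero_left hz]
  exact hD

/-! ### Binary quartics, the catalecticant and the null lift. -/

noncomputable section

/-- The coordinates of `v` in a null frame, scaled so that they become the coefficients `aᵢ` of a
binary quartic `∑ (4 choose i) aᵢ u⁴⁻ⁱ vⁱ`. -/
def quarticCoord (X₀ X₁ X₂ X₃ X₄ v : Fin 5 → ℝ) : Fin 5 → ℝ :=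
  ![9 / 2 * pseudoInner 2 v X₄, -(9 / 4) * pseudoInner 2 v X₃, 9 / 4 * pseudoInner 2 v X₂,
    -(27 / 8) * pseudoInner 2 v X₁, 27 / 4 * pseudoInner 2 v X₀]

/-- The catalecticant of a binary quartic. -/
def hankelDet (a : Fin 5 → ℝ) : ℝ :=
  a 0 * a 2 * a 4 + 2 * a 1 * a 2 * a 3 - a 2 ^ 3 - a 0 * a 3 ^ 2 - a 1 ^ 2 * a 4

/-- The identification of binary quartics with `𝔼⁵_2` under which fourth powers go to the cone
over the Lorentzian Veronese surface. -/
def quarticToVec : (Fin 5 → ℝ) →ₗ[ℝ] (Fin 5 → ℝ) where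
  toFun a := ![(a 0 - a 4) / (3 * √3), 2 * (a 1 + a 3) / (3 * √3), (a 0 + 2 * a 2 + a 4) / 6,
    (a 0 - 6 * a 2 + a 4) / (6 * √3), 2 * (a 1 - a 3) / (3 * √3)]
  map_add' a b := by ext i; fin_cases i <;> simp <;> ring
  map_smul' c a := by ext i; fin_cases i <;> simp <;> ring

lemma quarticToVec_apply (a : Fin 5 → ℝ) : quarticToVec a =
    ![(a 0 - a 4) / (3 * √3), 2 * (a 1 + a 3) / (3 * √3), (a 0 + 2 * a 2 + a 4) / 6,
      (a 0 - 6 * a 2 + a 4) / (6 * √3), 2 * (a 1 - a 3) / (3 * √3)] := rfl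

lemma inv_sqrt_three_sq : (√3)⁻¹ ^ 2 = (1 / 3 : ℝ) := by
  rw [inv_pow, Real.sq_sqrt (by norm_num)]
  norm_num

/-- The right-hand side is a multiple of the SL(2, ℝ)-invariant apolar pairing. -/
lemma pseudoInner_quarticToVec (a b : Fin 5 → ℝ) :
    pseudoInner 2 (quarticToVec a) (quarticToVec b) = 2 / 27 *
      (a 0 * b 4 + a 4 * b 0 - 4 * a 1 * b 3 - 4 * a 3 * b 1 + 6 * a 2 * b 2) := by
  have h := inv_sqrt_three_sq
  simp only [pseudoInner_five, quarticToVec_apply, div_eq_mul_inv, mul_inv]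
  simp
  linear_combination (-(a 0 - a 4) * (b 0 - b 4) / 9 - 4 * (a 1 + a 3) * (b 1 + b 3) / 9
    + (a 0 - 6 * a 2 + a 4) * (b 0 - 6 * b 2 + b 4) / 36 + 4 * (a 1 - a 3) * (b 1 - b 3) / 9) * h

/-- The conclusion is the coefficient of ε in the cubic polynomial on the left of `h`. On the right
this coefficient vanishes, because all 2 × 2 minors of the rank-one Hankel matrix of (2, 0, 0, 0, 0)
are zero. -/
lemma hankelDet_grad_eq_zero {b d e : Fin 5 → ℝ}
    (h : ∀ ε : ℝ, hankelDet (b + ε • e) = hankelDet (![2, 0, 0, 0, 0] + ε • d)) :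
    e 0 * (b 2 * b 4 - b 3 ^ 2) + e 1 * (2 * b 2 * b 3 - 2 * b 1 * b 4)
      + e 2 * (b 0 * b 4 + 2 * b 1 * b 3 - 3 * b 2 ^ 2) + e 3 * (2 * b 1 * b 2 - 2 * b 0 * b 3)
      + e 4 * (b 0 * b 2 - b 1 ^ 2) = 0 := by
  have h0 := h 0
  have h1 := h 1
  have h2 := h (-1)
  have h3 := h 2
  simp [hankelDet] at h0 h1 h2 h3
  -- These weights at ε = 1, -1, 2, 0 extract the linear coefficient of any cubic.
  linear_combination h1 - h2 / 3 - h3 / 6 - h0 / 2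

namespace IsNullFrame

variable {X₀ X₁ X₂ X₃ X₄ : Fin 5 → ℝ}

lemma exists_quarticCoord_eq (h : IsNullFrame X₀ X₁ X₂ X₃ X₄) (e : Fin 5 → ℝ) :
    ∃ u, quarticCoord X₀ X₁ X₂ X₃ X₄ u = e := by
  refine ⟨(e 0 / 2) • X₀ + e 1 • X₁ + e 2 • X₂ + (2 / 3 * e 3) • X₃ + (1 / 3 * e 4) • X₄, ?_⟩
  simp only [quarticCoord, pseudoInner_add_left, pseudoInner_smul_left,
    h.h00, h.h01, h.h02, h.h03, h.h04,
      h.h11, h.h12, h.h13, h.h14, h.h22, h.h23, h.h24, h.h33, h.h34, h.h44,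
      pseudoInner_comm 2 X₁ X₀, pseudoInner_comm 2 X₂ X₀, pseudoInner_comm 2 X₃ X₀,
      pseudoInner_comm 2 X₄ X₀, pseudoInner_comm 2 X₂ X₁, pseudoInner_comm 2 X₃ X₁,
      pseudoInner_comm 2 X₄ X₁, pseudoInner_comm 2 X₃ X₂, pseudoInner_comm 2 X₄ X₂,
      pseudoInner_comm 2 X₄ X₃]
  ext i
  fin_cases i <;> simp <;> ring

lemma quarticCoord_self (h : IsNullFrame X₀ X₁ X₂ X₃ X₄) :
    quarticCoord X₀ X₁ X₂ X₃ X₄ X₀ = ![2, 0, 0, 0, 0] := by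
  simp only [quarticCoord, h.h00, h.h01, h.h02, h.h03, h.h04]
  ext i
  fin_cases i <;> norm_num

end IsNullFrame

lemma quarticCoord_add (X₀ X₁ X₂ X₃ X₄ v w : Fin 5 → ℝ) :
    quarticCoord X₀ X₁ X₂ X₃ X₄ (v + w)
      = quarticCoord X₀ X₁ X₂ X₃ X₄ v + quarticCoord X₀ X₁ X₂ X₃ X₄ w := by
  simp only [quarticCoord, pseudoInner_add_left]
  ext i
  fin_cases i <;> simp <;> ring

lemma quarticCoord_smul (X₀ X₁ X₂ X₃ X₄ : Fin 5 → ℝ) (c : ℝ) (v : Fin 5 → ℝ) :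
    quarticCoord X₀ X₁ X₂ X₃ X₄ (c • v) = c • quarticCoord X₀ X₁ X₂ X₃ X₄ v := by
  simp only [quarticCoord, pseudoInner_smul_left]
  ext i
  fin_cases i <;> simp <;> ring

/-- The scalings in `quarticCoord` turn the null frame's Gram matrix into the apolar pairing; an
isometric endomorphism is injective by nondegeneracy. -/
lemma IsNullFrame.exists_isometry {X₀ X₁ X₂ X₃ X₄ : Fin 5 → ℝ}
    (h : IsNullFrame X₀ X₁ X₂ X₃ X₄) :
    ∃ A : (Fin 5 → ℝ) ≃ₗ[ℝ] (Fin 5 → ℝ),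
      (∀ v w, pseudoInner 2 (A v) (A w) = pseudoInner 2 v w) ∧
      ∀ v, A v = quarticToVec (quarticCoord X₀ X₁ X₂ X₃ X₄ v) := by
  let Q : (Fin 5 → ℝ) →ₗ[ℝ] (Fin 5 → ℝ) :=
    { toFun := quarticCoord X₀ X₁ X₂ X₃ X₄
      map_add' := quarticCoord_add X₀ X₁ X₂ X₃ X₄
      map_smul' := quarticCoord_smul X₀ X₁ X₂ X₃ X₄ }
  let L := quarticToVec ∘ₗ Q
  have hiso (v w : Fin 5 → ℝ) : pseudoInner 2 (L v) (L w) = pseudoInner 2 v w := by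
    rw [h.pseudoInner_eq v w]
    simp only [L, Q, LinearMap.comp_apply, LinearMap.coe_mk, AddHom.coe_mk,
      pseudoInner_quarticToVec, quarticCoord]
    simp
    ring
  have hinj : Function.Injective L := by
    rw [injective_iff_map_eq_zero]
    intro v hv
    refine eq_zero_of_pseudoInner_eq_zero 2 v fun w => ?_
    rw [← hiso, hv]
    simp [pseudoInner]
  exact ⟨LinearEquiv.ofInjectiveEndo L hinj, hiso, fun v => rfl⟩

/-- A null curve whose normalised osculating frame satisfies the structure equations of the rational
normal curve lies, up to an isometry, on the image of the light cone of `𝔼³₁` under the Veronese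
map. -/
lemma exists_null_lift {I : Set ℝ} (hI : IsOpen I) (hIc : I.OrdConnected)
    {α X₁ X₂ X₃ X₄ : ℝ → Fin 5 → ℝ} {κ : ℝ → ℝ} (hα : ContDiffOn ℝ ∞ α I)
    (hX : ∀ t ∈ I, IsNullFrame (α t) (X₁ t) (X₂ t) (X₃ t) (X₄ t) ∧
      HasDerivAt α (X₁ t) t ∧
      HasDerivAt X₁ (X₂ t - (3 * κ t) • α t) t ∧
      HasDerivAt X₂ (X₃ t - (9 / 2 * κ t) • X₁ t) t ∧
      HasDerivAt X₃ (X₄ t - (9 / 2 * κ t) • X₂ t) t ∧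
      HasDerivAt X₄ (-(3 * κ t) • X₃ t) t) {t₀ : ℝ} (ht₀ : t₀ ∈ I) :
    ∃ (A : (Fin 5 → ℝ) ≃ₗ[ℝ] (Fin 5 → ℝ)) (β : ℝ → Fin 3 → ℝ),
      (∀ v w, pseudoInner 2 (A v) (A w) = pseudoInner 2 v w) ∧
      ContDiffOn ℝ ∞ β I ∧ ∀ t ∈ I, 0 < β t 0 ∧ pseudoInner 1 (β t) (β t) = 0 ∧
        A (α t) = (2 : ℝ) • lorentzVeronese (β t) := by
  set Q : ℝ → (Fin 5 → ℝ) → (Fin 5 → ℝ) :=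
    fun t v => quarticCoord (α t) (X₁ t) (X₂ t) (X₃ t) (X₄ t) v with hQ
  have hIp : IsPreconnected I := hIc.isPreconnected
  have hconst (v : Fin 5 → ℝ) {s t : ℝ} (hs : s ∈ I) (ht : t ∈ I) :
      hankelDet (Q s v) = hankelDet (Q t v) := by
    -- Infinitesimal invariance of the catalecticant: the structure equations act on the coordinates
    -- of the fixed vector `v` through sl(2).
    have hder : ∀ t ∈ I, HasDerivAt (fun t => hankelDet (Q t v)) 0 t := by
      intro t ht
      obtain ⟨F, d0, d1, d2, d3, d4⟩ := hX t ht
      have c := hasDerivAt_const t v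
      have e0 := (c.pseudoInner 2 d4).const_mul (9 / 2)
      have e1 := (c.pseudoInner 2 d3).const_mul (-(9 / 4))
      have e2 := (c.pseudoInner 2 d2).const_mul (9 / 4)
      have e3 := (c.pseudoInner 2 d1).const_mul (-(27 / 8))
      have e4 := (c.pseudoInner 2 d0).const_mul (27 / 4)
      have := ((((e0.mul e2).mul e4).add (((e1.const_mul 2).mul e2).mul e3)).sub
        (e2.pow 3)).sub (e0.mul (e3.pow 2)) |>.sub ((e1.pow 2).mul e4)
      refine this.congr_deriv ?_
      have hz (w : Fin 5 → ℝ) : pseudoInner 2 0 w = 0 := by simp [pseudoInner]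
      simp only [hz, sub_eq_add_neg, ← neg_smul, pseudoInner_add_right, pseudoInner_smul_right,
        Pi.mul_apply, Pi.pow_apply]
      push_cast
      ring
    exact hI.is_const_of_deriv_eq_zero hIp
      (fun t ht => (hder t ht).differentiableAt.differentiableWithinAt)
      (fun t ht => (hder t ht).deriv) hs ht
  obtain ⟨F₀, -⟩ := hX t₀ ht₀
  obtain ⟨A, hA, hAQ⟩ := F₀.exists_isometry
  set b : ℝ → Fin 5 → ℝ := fun t => Q t₀ (α t) with hb
  have hAb (t : ℝ) : A (α t) = quarticToVec (b t) := hAQ _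
  have hgrad {t : ℝ} (ht : t ∈ I) (e : Fin 5 → ℝ) :
      e 0 * (b t 2 * b t 4 - b t 3 ^ 2) + e 1 * (2 * b t 2 * b t 3 - 2 * b t 1 * b t 4)
      + e 2 * (b t 0 * b t 4 + 2 * b t 1 * b t 3 - 3 * b t 2 ^ 2)
      + e 3 * (2 * b t 1 * b t 2 - 2 * b t 0 * b t 3)
      + e 4 * (b t 0 * b t 2 - b t 1 ^ 2) = 0 := by
    obtain ⟨u, rfl⟩ := F₀.exists_quarticCoord_eq e
    refine hankelDet_grad_eq_zero (d := Q t u) fun ε => ?_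
    rw [← (hX t ht).1.quarticCoord_self]
    simp only [hb, hQ]
    rw [← quarticCoord_smul, ← quarticCoord_smul, ← quarticCoord_add, ← quarticCoord_add]
    exact hconst _ ht₀ ht
  -- A vanishing gradient gives four of the minors and b₀b₄ + 2b₁b₃ = 3b₂². Nullity gives b₀b₄ +
  -- 3b₂² = 4b₁b₃, which separates the remaining two minors.
  have hrank {t : ℝ} (ht : t ∈ I) : b t 2 * b t 4 = b t 3 ^ 2 ∧ b t 2 * b t 3 = b t 1 * b t 4 ∧
      b t 1 * b t 2 = b t 0 * b t 3 ∧ b t 0 * b t 2 = b t 1 ^ 2 ∧ b t 0 * b t 4 = b t 2 ^ 2 ∧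
      b t 1 * b t 3 = b t 2 ^ 2 := by
    have h0 := hgrad ht ![1, 0, 0, 0, 0]
    have h1 := hgrad ht ![0, 1, 0, 0, 0]
    have h2 := hgrad ht ![0, 0, 1, 0, 0]
    have h3 := hgrad ht ![0, 0, 0, 1, 0]
    have h4 := hgrad ht ![0, 0, 0, 0, 1]
    have h5 := hA (α t) (α t)
    rw [(hX t ht).1.h00, hAb, pseudoInner_quarticToVec] at h5
    simp at h0 h1 h2 h3 h4
    refine ⟨?_, ?_, ?_, ?_, ?_, ?_⟩ <;> linarith
  have hbne {t : ℝ} (ht : t ∈ I) : b t ≠ 0 := by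
    intro h
    have h1 : A (α t) = 0 := by rw [hAb, h, map_zero]
    have h2 : α t = 0 := by simpa using h1
    have h3 := (hX t ht).1.h04
    rw [h2] at h3
    norm_num [pseudoInner] at h3
  -- This is the third coordinate of A α. For A α = 2 V(z, x, y) with x² + y² = z² it equals z², so
  -- the lift is found from its square root.
  set q : ℝ → ℝ := fun t => (b t 0 + 2 * b t 2 + b t 4) / 6 with hq
  have hqne {t : ℝ} (ht : t ∈ I) : q t ≠ 0 := by
    intro h
    obtain ⟨h1, h2, h3, h4, h5, h6⟩ := hrank ht
    have h7 : b t 0 + 2 * b t 2 + b t 4 = 0 := by simp only [hq] at h; linarith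
    -- If q = 0, then b₀ = b₄ = -b₂, so b₁² = b₀b₂ = -b₀² and every coordinate vanishes.
    have e0 : b t 0 = b t 4 := by
      have : (b t 0 - b t 4) ^ 2 = 0 := by
        linear_combination (b t 0 + b t 4 - 2 * b t 2) * h7 - 4 * h5
      exact sub_eq_zero.1 (pow_eq_zero_iff two_ne_zero |>.1 this)
    have e2 : b t 2 = - b t 0 := by linarith
    have z0 : b t 0 = 0 := by nlinarith [sq_nonneg (b t 1), sq_nonneg (b t 0)]
    have z1 : b t 1 = 0 := by
      rw [z0, zero_mul] at h4
      exact pow_eq_zero_iff two_ne_zero |>.1 h4.symm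
    have z3 : b t 3 = 0 := by
      rw [← e0, z0, mul_zero] at h1
      exact pow_eq_zero_iff two_ne_zero |>.1 h1.symm
    apply hbne ht
    funext i
    fin_cases i
    exacts [z0, z1, by simp [e2, z0], z3, e0.symm.trans z0]
  have hbs (i : Fin 5) : ContDiffOn ℝ ∞ (fun t => b t i) I := by
    have hc (c : ℝ) (v : Fin 5 → ℝ) : ContDiffOn ℝ ∞ (fun t => c * pseudoInner 2 (α t) v) I :=
      contDiffOn_const.mul (hα.pseudoInner 2 contDiffOn_const)
    fin_cases i <;> exact hc _ _
  have hqs : ContDiffOn ℝ ∞ q I :=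
    (((hbs 0).add (contDiffOn_const.mul (hbs 2))).add (hbs 4)).div_const 6
  have hq0 : 0 < q t₀ := by
    have : b t₀ = ![2, 0, 0, 0, 0] := F₀.quarticCoord_self
    simp [hq, this]
  -- q is continuous and zero-free on the interval and equals 1/3 at `t₀`, so it cannot change sign.
  have hqpos {t : ℝ} (ht : t ∈ I) : 0 < q t := by
    by_contra! h
    obtain ⟨s, hs, hs0⟩ := hIp.intermediate_value ht ht₀ hqs.continuousOn ⟨h, hq0.le⟩
    exact hqne hs hs0
  set z : ℝ → ℝ := fun t => √(q t) with hz
  have hzpos {t : ℝ} (ht : t ∈ I) : 0 < z t := Real.sqrt_pos.2 (hqpos ht)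
  have hzz {t : ℝ} (ht : t ∈ I) : z t ^ 2 = q t := Real.sq_sqrt (hqpos ht).le
  have hzs : ContDiffOn ℝ ∞ z I := hqs.sqrt fun t ht => hqne ht
  refine ⟨A, fun t => ![z t, (b t 0 - b t 4) / (6 * z t), (b t 1 + b t 3) / (3 * z t)], hA, ?_,
    fun t ht => ?_⟩
  · rw [contDiffOn_pi]
    intro i
    fin_cases i
    · exact hzs
    · exact ((hbs 0).sub (hbs 4)).div (contDiffOn_const.mul hzs) fun t ht =>
        mul_ne_zero (by norm_num) (hzpos ht).ne'
    · exact ((hbs 1).add (hbs 3)).div (contDiffOn_const.mul hzs) fun t ht =>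
        mul_ne_zero (by norm_num) (hzpos ht).ne'
  · have hp := hzpos ht
    have h2 := hzz ht
    obtain ⟨r1, r2, r3, r4, r5, r6⟩ := hrank ht
    set x := (b t 0 - b t 4) / (6 * z t) with hx
    set y := (b t 1 + b t 3) / (3 * z t) with hy
    have exz : x * z t = (b t 0 - b t 4) / 6 := by rw [hx]; field_simp
    have eyz : y * z t = (b t 1 + b t 3) / 3 := by rw [hy]; field_simp
    have cancel {u w : ℝ} (h : u * z t ^ 2 = w * z t ^ 2) : u = w :=
      mul_right_cancel₀ (pow_ne_zero 2 hp.ne') h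
    have exx : x ^ 2 = (b t 0 - 2 * b t 2 + b t 4) / 6 := by
      apply cancel
      rw [← mul_pow, exz, h2]
      simp only [hq]
      linear_combination -1 / 9 * r5
    have eyy : y ^ 2 = 2 * b t 2 / 3 := by
      apply cancel
      rw [← mul_pow, eyz, h2]
      simp only [hq]
      linear_combination -1 / 9 * r4 - 1 / 9 * r1 + 2 / 9 * r6
    have exy : x * y = (b t 1 - b t 3) / 3 := by
      apply cancel
      rw [show x * y * z t ^ 2 = (x * z t) * (y * z t) by ring, exz, eyz, h2]
      simp only [hq]
      linear_combination (r2 - r3) / 9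
    have hzz' : z t ^ 2 = (b t 0 + 2 * b t 2 + b t 4) / 6 := h2
    change 0 < z t ∧ pseudoInner 1 ![z t, x, y] ![z t, x, y] = 0 ∧
      A (α t) = (2 : ℝ) • lorentzVeronese ![z t, x, y]
    clear_value x y
    refine ⟨hp, ?_, ?_⟩
    · simp only [pseudoInner_three]
      simp
      linear_combination exx + eyy - hzz'
    · rw [hAb, quarticToVec_apply]
      ext i
      fin_cases i <;> simp [lorentzVeronese, exz, eyz, exy, exx, eyy, hzz'] <;> ring

end

/-! ### The polarised Veronese map and null triples in 𝔼³₁. -/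

noncomputable section

/-- The symmetric bilinear map polarising the quadratic map `lorentzVeronese`. -/
def veronesePolar (p q : Fin 3 → ℝ) : Fin 5 → ℝ :=
  ![(p 1 * q 0 + q 1 * p 0) / (2 * √3),
    (p 2 * q 0 + q 2 * p 0) / (2 * √3),
    (p 1 * q 1 + p 2 * q 2 + 2 * (p 0 * q 0)) / 6,
    (p 1 * q 1 - p 2 * q 2) / (2 * √3),
    (p 1 * q 2 + q 1 * p 2) / (2 * √3)]

lemma veronesePolar_self (p : Fin 3 → ℝ) : veronesePolar p p = lorentzVeronese p := by
  ext i
  fin_cases i <;> simp [veronesePolar, lorentzVeronese] <;> ring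

lemma veronesePolar_comm (p q : Fin 3 → ℝ) : veronesePolar p q = veronesePolar q p := by
  ext i
  fin_cases i <;> simp [veronesePolar] <;> ring

lemma veronesePolar_add_left (p q r : Fin 3 → ℝ) :
    veronesePolar (p + q) r = veronesePolar p r + veronesePolar q r := by
  ext i
  fin_cases i <;> simp [veronesePolar] <;> ring

lemma veronesePolar_smul_left (c : ℝ) (p q : Fin 3 → ℝ) :
    veronesePolar (c • p) q = c • veronesePolar p q := by
  ext i
  fin_cases i <;> simp [veronesePolar] <;> ring

lemma veronesePolar_add_right (p q r : Fin 3 → ℝ) :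
    veronesePolar r (p + q) = veronesePolar r p + veronesePolar r q := by
  simp only [veronesePolar_comm r, veronesePolar_add_left]

lemma veronesePolar_smul_right (c : ℝ) (p q : Fin 3 → ℝ) :
    veronesePolar q (c • p) = c • veronesePolar q p := by
  simp only [veronesePolar_comm q, veronesePolar_smul_left]

/-- One sixth of the inner product of trace-free parts of symmetric products; the last term removes
the traces. -/
lemma pseudoInner_veronesePolar (p q r s : Fin 3 → ℝ) :
    pseudoInner 2 (veronesePolar p q) (veronesePolar r s) =
      (pseudoInner 1 p r * pseudoInner 1 q s + pseudoInner 1 p s * pseudoInner 1 q r) / 12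
        - pseudoInner 1 p q * pseudoInner 1 r s / 18 := by
  have h := inv_sqrt_three_sq
  simp only [pseudoInner_five, pseudoInner_three, veronesePolar, div_eq_mul_inv, mul_inv]
  simp
  linear_combination (-(p 1 * q 0 + q 1 * p 0) * (r 1 * s 0 + s 1 * r 0) / 4
    - (p 2 * q 0 + q 2 * p 0) * (r 2 * s 0 + s 2 * r 0) / 4
    + (p 1 * q 1 - p 2 * q 2) * (r 1 * s 1 - r 2 * s 2) / 4
    + (p 1 * q 2 + q 1 * p 2) * (r 1 * s 2 + s 1 * r 2) / 4) * h

lemma HasDerivAt.veronesePolar {f g : ℝ → Fin 3 → ℝ} {f' g' : Fin 3 → ℝ} {t : ℝ}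
    (hf : HasDerivAt f f' t) (hg : HasDerivAt g g' t) :
    HasDerivAt (fun s => veronesePolar (f s) (g s))
      (_root_.veronesePolar f' (g t) + _root_.veronesePolar (f t) g') t := by
  rw [hasDerivAt_pi] at hf hg ⊢
  intro i
  fin_cases i
  · exact ((((hf 1).mul (hg 0)).add ((hg 1).mul (hf 0))).div_const _).congr_deriv (by
      simp [_root_.veronesePolar]; ring)
  · exact ((((hf 2).mul (hg 0)).add ((hg 2).mul (hf 0))).div_const _).congr_deriv (by
      simp [_root_.veronesePolar]; ring)
  · exact (((((hf 1).mul (hg 1)).add ((hf 2).mul (hg 2))).add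
      (((hf 0).mul (hg 0)).const_mul 2)).div_const _).congr_deriv (by
      simp [_root_.veronesePolar]; ring)
  · exact ((((hf 1).mul (hg 1)).sub ((hf 2).mul (hg 2))).div_const _).congr_deriv (by
      simp [_root_.veronesePolar]; ring)
  · exact ((((hf 1).mul (hg 2)).add ((hg 1).mul (hf 2))).div_const _).congr_deriv (by
      simp [_root_.veronesePolar]; ring)

/-- The Gram relations of the frame `(β, β', β'')` of a null curve in `𝔼³₁` with
`⟨β', β'⟩ = 1 / 3`. -/
structure IsNullTriple (p q r : Fin 3 → ℝ) : Prop where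
  pp : pseudoInner 1 p p = 0
  pq : pseudoInner 1 p q = 0
  qq : pseudoInner 1 q q = 1 / 3
  pr : pseudoInner 1 p r = -(1 / 3)
  qr : pseudoInner 1 q r = 0

namespace IsNullTriple

variable {p q r : Fin 3 → ℝ}

lemma expansion (h : IsNullTriple p q r) (v : Fin 3 → ℝ) :
    v = (-3 * pseudoInner 1 v r - 9 * pseudoInner 1 r r * pseudoInner 1 v p) • p
      + (3 * pseudoInner 1 v q) • q + (-3 * pseudoInner 1 v p) • r := by
  let L : (Fin 3 → ℝ) →ₗ[ℝ] (Fin 3 → ℝ) :=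
    (LinearMap.proj 0).smulRight p + (LinearMap.proj 1).smulRight q
      + (LinearMap.proj 2).smulRight r
  have hL (a : Fin 3 → ℝ) : L a = a 0 • p + a 1 • q + a 2 • r := rfl
  have key (a : Fin 3 → ℝ) :
      -3 * pseudoInner 1 (L a) r - 9 * pseudoInner 1 r r * pseudoInner 1 (L a) p = a 0 ∧
      3 * pseudoInner 1 (L a) q = a 1 ∧ -3 * pseudoInner 1 (L a) p = a 2 := by
    simp only [hL, pseudoInner_add_left, pseudoInner_smul_left, h.pp, h.pq, h.qq, h.pr, h.qr,
      pseudoInner_comm 1 q p, pseudoInner_comm 1 r p, pseudoInner_comm 1 r q]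
    refine ⟨?_, ?_, ?_⟩ <;> ring
  have hinj : Function.Injective L := by
    intro a b hab
    obtain ⟨a0, a1, a2⟩ := key a
    obtain ⟨b0, b1, b2⟩ := key b
    rw [hab] at a0 a1 a2
    funext i
    fin_cases i
    exacts [a0.symm.trans b0, a1.symm.trans b1, a2.symm.trans b2]
  obtain ⟨a, rfl⟩ := LinearMap.injective_iff_surjective.1 hinj v
  obtain ⟨a0, a1, a2⟩ := key a
  rw [a0, a1, a2, ← hL]

/-- The polarised Veronese map kills the inverse metric tensor. -/
lemma veronesePolar_trace (h : IsNullTriple p q r) :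
    veronesePolar q q = (2 : ℝ) • veronesePolar p r
      + (3 * pseudoInner 1 r r) • veronesePolar p p := by
  -- Expanding the standard basis vectors writes the inverse metric in terms of p, q, r. Each
  -- Veronese component is a trace-free quadratic form, so it vanishes on that tensor.
  have e (i j : Fin 3) := congrFun (h.expansion (Pi.single j 1)) i
  generalize pseudoInner 1 r r = ρ at e ⊢
  have e00 := e 0 0
  have e01 := e 0 1
  have e02 := e 0 2
  have e11 := e 1 1
  have e12 := e 1 2
  have e22 := e 2 2
  simp [pseudoInner_three] at e00 e01 e02 e11 e12 e22
  ext i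
  fin_cases i <;> simp [veronesePolar]
  · field_simp; linarith
  · field_simp; linarith
  · linarith
  · field_simp; linarith
  · field_simp; linarith

end IsNullTriple

lemma LinearEquiv.hasDerivAt_comp {m n : ℕ} (A : (Fin m → ℝ) ≃ₗ[ℝ] (Fin n → ℝ))
    {f : ℝ → Fin m → ℝ} {f' : Fin m → ℝ} {t : ℝ} (hf : HasDerivAt f f' t) :
    HasDerivAt (fun s => A (f s)) (A f') t :=
  (LinearMap.toContinuousLinearMap A.toLinearMap).hasFDerivAt.comp_hasDerivAt t hf

/-! ### Geometry of the null lift and the ruled parametrisation. -/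

section NullLift

variable {I : Set ℝ} {α : ℝ → Fin 5 → ℝ} {A : (Fin 5 → ℝ) ≃ₗ[ℝ] (Fin 5 → ℝ)}
  {β : ℝ → Fin 3 → ℝ}

lemma deriv_null_lift (hI : IsOpen I) (hα : ContDiffOn ℝ ∞ α I) (hβ : ContDiffOn ℝ ∞ β I)
    (hAβ : ∀ t ∈ I, A (α t) = (2 : ℝ) • lorentzVeronese (β t)) {t : ℝ} (ht : t ∈ I) :
    A (deriv α t) = (4 : ℝ) • veronesePolar (β t) (deriv β t) ∧
    A (iteratedDeriv 2 α t) = (4 : ℝ) • veronesePolar (deriv β t) (deriv β t)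
      + (4 : ℝ) • veronesePolar (β t) (iteratedDeriv 2 β t) ∧
    A (iteratedDeriv 3 α t) = (12 : ℝ) • veronesePolar (deriv β t) (iteratedDeriv 2 β t)
      + (4 : ℝ) • veronesePolar (β t) (iteratedDeriv 3 β t) := by
  have a0 {t : ℝ} (ht : t ∈ I) := hα.hasDerivAt_deriv hI ht
  have a1 {t : ℝ} (ht : t ∈ I) : HasDerivAt (deriv α) (iteratedDeriv 2 α t) t := by
    simpa [iteratedDeriv_one] using hα.hasDerivAt_iteratedDeriv hI 1 ht
  have a2 {t : ℝ} (ht : t ∈ I) := hα.hasDerivAt_iteratedDeriv hI 2 ht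
  have b0 {t : ℝ} (ht : t ∈ I) := hβ.hasDerivAt_deriv hI ht
  have b1 {t : ℝ} (ht : t ∈ I) : HasDerivAt (deriv β) (iteratedDeriv 2 β t) t := by
    simpa [iteratedDeriv_one] using hβ.hasDerivAt_iteratedDeriv hI 1 ht
  have b2 {t : ℝ} (ht : t ∈ I) := hβ.hasDerivAt_iteratedDeriv hI 2 ht
  have h1 : ∀ t ∈ I, A (deriv α t) = (4 : ℝ) • veronesePolar (β t) (deriv β t) := by
    intro t ht
    rw [HasDerivAt.eq_of_eqOn hI ht hAβ (A.hasDerivAt_comp (a0 ht))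
      (by simpa only [veronesePolar_self] using
        ((b0 ht).veronesePolar (b0 ht)).fun_const_smul (2 : ℝ)),
      veronesePolar_comm (deriv β t)]
    module
  have h2 : ∀ t ∈ I, A (iteratedDeriv 2 α t) = (4 : ℝ) • veronesePolar (deriv β t) (deriv β t)
      + (4 : ℝ) • veronesePolar (β t) (iteratedDeriv 2 β t) := by
    intro t ht
    rw [HasDerivAt.eq_of_eqOn hI ht h1 (A.hasDerivAt_comp (a1 ht))
      (((b0 ht).veronesePolar (b1 ht)).const_smul (4 : ℝ))]
    module
  refine ⟨h1 t ht, h2 t ht, ?_⟩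
  rw [HasDerivAt.eq_of_eqOn hI ht h2 (A.hasDerivAt_comp (a2 ht))
      ((((b1 ht).veronesePolar (b1 ht)).const_smul (4 : ℝ)).add
        (((b0 ht).veronesePolar (b2 ht)).const_smul (4 : ℝ))),
      veronesePolar_comm (iteratedDeriv 2 β t)]
  module

/-- A vector orthogonal to a nonzero null vector of `𝔼³₁` is not timelike. -/
lemma pseudoInner_nonneg_of_orthogonal_null {p q : Fin 3 → ℝ} (h0 : 0 < p 0)
    (hpp : pseudoInner 1 p p = 0) (hpq : pseudoInner 1 p q = 0) : 0 ≤ pseudoInner 1 q q := by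
  rw [pseudoInner_three] at *
  have h1 : (p 0) ^ 2 * (-(q 0 * q 0) + q 1 * q 1 + q 2 * q 2)
      = (p 1 * q 2 - p 2 * q 1) ^ 2 := by
    linear_combination (-(p 0 * q 0) - (p 1 * q 1 + p 2 * q 2)) * -hpq
      - (q 1 ^ 2 + q 2 ^ 2) * hpp
  nlinarith [sq_nonneg (p 1 * q 2 - p 2 * q 1), pow_pos h0 2]

lemma null_lift_triple (hI : IsOpen I) (hα : ContDiffOn ℝ ∞ α I) (hβ : ContDiffOn ℝ ∞ β I)
    (hnorm : ∀ t ∈ I, pseudoInner 2 (iteratedDeriv 2 α t) (iteratedDeriv 2 α t) = 4 / 9)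
    (hA : ∀ v w, pseudoInner 2 (A v) (A w) = pseudoInner 2 v w)
    (hβ0 : ∀ t ∈ I, 0 < β t 0) (hββ : ∀ t ∈ I, pseudoInner 1 (β t) (β t) = 0)
    (hAβ : ∀ t ∈ I, A (α t) = (2 : ℝ) • lorentzVeronese (β t)) {t : ℝ} (ht : t ∈ I) :
    IsNullTriple (β t) (deriv β t) (iteratedDeriv 2 β t) ∧
    etaFun α t = 20 / 3 * pseudoInner 1 (iteratedDeriv 2 β t) (iteratedDeriv 2 β t) := by
  have b0 {t : ℝ} (ht : t ∈ I) := hβ.hasDerivAt_deriv hI ht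
  have b1 {t : ℝ} (ht : t ∈ I) : HasDerivAt (deriv β) (iteratedDeriv 2 β t) t := by
    simpa [iteratedDeriv_one] using hβ.hasDerivAt_iteratedDeriv hI 1 ht
  have b2 {t : ℝ} (ht : t ∈ I) := hβ.hasDerivAt_iteratedDeriv hI 2 ht
  have h01 : ∀ t ∈ I, pseudoInner 1 (β t) (deriv β t) = 0 := fun t ht => by
    have := HasDerivAt.eq_of_eqOn hI ht hββ ((b0 ht).pseudoInner 1 (b0 ht)) (hasDerivAt_const t _)
    linarith [pseudoInner_comm 1 (β t) (deriv β t)]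
  have h02' : ∀ t ∈ I, pseudoInner 1 (deriv β t) (deriv β t)
      + pseudoInner 1 (β t) (iteratedDeriv 2 β t) = 0 := fun t ht =>
    HasDerivAt.eq_of_eqOn hI ht h01 ((b0 ht).pseudoInner 1 (b1 ht)) (hasDerivAt_const t _)
  have h11 : ∀ t ∈ I, pseudoInner 1 (deriv β t) (deriv β t) = 1 / 3 := fun t ht => by
    have h := hnorm t ht
    rw [← hA, (deriv_null_lift hI hα hβ hAβ ht).2.1] at h
    simp only [pseudoInner_add_left, pseudoInner_add_right, pseudoInner_smul_left,
      pseudoInner_smul_right, pseudoInner_veronesePolar, hββ t ht, h01 t ht,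
      pseudoInner_comm 1 (deriv β t) (β t), pseudoInner_comm 1 (iteratedDeriv 2 β t) (β t),
      eq_neg_of_add_eq_zero_right (h02' t ht)] at h
    -- The norm of α'' gives only ⟨β', β'⟩² = 1/9; orthogonality to the null vector β fixes the
    -- sign.
    have hn := pseudoInner_nonneg_of_orthogonal_null (hβ0 t ht) (hββ t ht) (h01 t ht)
    have h3 : (pseudoInner 1 (deriv β t) (deriv β t)) ^ 2 = (1 / 3) ^ 2 := by linarith
    exact (sq_eq_sq₀ hn (by norm_num)).1 h3
  have h02 : ∀ t ∈ I, pseudoInner 1 (β t) (iteratedDeriv 2 β t) = -(1 / 3) := fun t ht => by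
    linarith [h02' t ht, h11 t ht]
  have h12 : ∀ t ∈ I, pseudoInner 1 (deriv β t) (iteratedDeriv 2 β t) = 0 := fun t ht => by
    have := HasDerivAt.eq_of_eqOn hI ht h11 ((b1 ht).pseudoInner 1 (b1 ht)) (hasDerivAt_const t _)
    linarith [pseudoInner_comm 1 (deriv β t) (iteratedDeriv 2 β t)]
  have h03 : pseudoInner 1 (β t) (iteratedDeriv 3 β t) = 0 := by
    have := HasDerivAt.eq_of_eqOn hI ht h02 ((b0 ht).pseudoInner 1 (b2 ht)) (hasDerivAt_const t _)
    linarith [h12 t ht]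
  have h13 := HasDerivAt.eq_of_eqOn hI ht h12 ((b1 ht).pseudoInner 1 (b2 ht))
    (hasDerivAt_const t _)
  refine ⟨⟨hββ t ht, h01 t ht, h11 t ht, h02 t ht, h12 t ht⟩, ?_⟩
  rw [etaFun, ← hA, (deriv_null_lift hI hα hβ hAβ ht).2.2]
  simp only [pseudoInner_add_left, pseudoInner_add_right, pseudoInner_smul_left,
      pseudoInner_smul_right, pseudoInner_veronesePolar, hββ t ht, h01 t ht, h11 t ht, h02 t ht,
      h12 t ht, h03, eq_neg_of_add_eq_zero_right h13,
      pseudoInner_comm 1 (deriv β t) (β t), pseudoInner_comm 1 (iteratedDeriv 2 β t) (β t),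
      pseudoInner_comm 1 (iteratedDeriv 2 β t) (deriv β t),
      pseudoInner_comm 1 (iteratedDeriv 3 β t) (β t),
      pseudoInner_comm 1 (iteratedDeriv 3 β t) (deriv β t)]
  ring

/-- The ruled parametrisation of `𝕊²₁(1/3)` along a null curve. -/
def ruledMap (β : ℝ → Fin 3 → ℝ) (p : ℝ × ℝ) : Fin 3 → ℝ :=
  p.1 • β p.2 + (3 : ℝ) • deriv β p.2

/-- The trace identity trades the β, β'' term for β', β' and β, β terms. With η = 20/3 ⟨β'', β''⟩,
the summand 27/40 η cancels the latter, leaving the expansion of V(s β + 3 β'). -/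
lemma isometry_surfaceOf_eq (hI : IsOpen I) (hα : ContDiffOn ℝ ∞ α I) (hβ : ContDiffOn ℝ ∞ β I)
    (hAβ : ∀ t ∈ I, A (α t) = (2 : ℝ) • lorentzVeronese (β t)) {p : ℝ × ℝ} (hp : p.2 ∈ I)
    (h3 : IsNullTriple (β p.2) (deriv β p.2) (iteratedDeriv 2 β p.2))
    (hη : etaFun α p.2
      = 20 / 3 * pseudoInner 1 (iteratedDeriv 2 β p.2) (iteratedDeriv 2 β p.2)) :
    A (surfaceOf α p) = lorentzVeronese (ruledMap β p) := by
  obtain ⟨h1, h2, -⟩ := deriv_null_lift hI hα hβ hAβ hp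
  simp only [surfaceOf, map_add, map_smul, hAβ _ hp, h1, h2, hη, ruledMap, ← veronesePolar_self,
    veronesePolar_add_left, veronesePolar_add_right, veronesePolar_smul_left,
    veronesePolar_smul_right, veronesePolar_comm (deriv β p.2) (β p.2), h3.veronesePolar_trace]
  module

lemma ruledMap_mem_sphere {p : ℝ × ℝ}
    (h3 : IsNullTriple (β p.2) (deriv β p.2) (iteratedDeriv 2 β p.2)) :
    pseudoInner 1 (ruledMap β p) (ruledMap β p) = 3 := by
  simp only [ruledMap, pseudoInner_add_left, pseudoInner_add_right, pseudoInner_smul_left,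
    pseudoInner_smul_right, h3.pp, h3.pq, h3.qq, pseudoInner_comm 1 (deriv β p.2) (β p.2)]
  ring

lemma contDiffOn_ruledMap (hI : IsOpen I) (hβ : ContDiffOn ℝ ∞ β I) :
    ContDiffOn ℝ ∞ (ruledMap β) (univ ×ˢ I) := by
  have hm : MapsTo (Prod.snd : ℝ × ℝ → ℝ) (univ ×ˢ I) I := fun p hp => hp.2
  exact (contDiff_fst.contDiffOn.smul (hβ.comp contDiff_snd.contDiffOn hm)).add
    (((hβ.deriv_of_isOpen hI (by simp)).comp contDiff_snd.contDiffOn hm).const_smul (3 : ℝ))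

end NullLift

/-! ### The induced metric and openness of the image. -/

lemma HasDerivAt.line {E : Type*} [NormedAddCommGroup E] [NormedSpace ℝ E] (p v : E) :
    HasDerivAt (fun τ : ℝ => p + τ • v) v 0 := by
  simpa using ((hasDerivAt_id (0 : ℝ)).smul_const v).const_add p

/-- If `x` is, up to an isometry, the composition of the Veronese map with a map into
`𝕊²₁(1/3)`, then that map preserves the induced metric. -/
lemma pseudoInner_fderiv_eq {E : Type*} [NormedAddCommGroup E] [NormedSpace ℝ E]
    {D : Set E} (hD : IsOpen D) {x : E → Fin 5 → ℝ} {ψ : E → Fin 3 → ℝ}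
    {A : (Fin 5 → ℝ) ≃ₗ[ℝ] (Fin 5 → ℝ)} (hA : ∀ v w, pseudoInner 2 (A v) (A w) = pseudoInner 2 v w)
    (hψ : ∀ p ∈ D, DifferentiableAt ℝ ψ p) (hS : ∀ p ∈ D, pseudoInner 1 (ψ p) (ψ p) = 3)
    (hx : ∀ p ∈ D, A (x p) = lorentzVeronese (ψ p)) {p : E} (hp : p ∈ D) (v w : E) :
    pseudoInner 1 (fderiv ℝ ψ p v) (fderiv ℝ ψ p w)
      = pseudoInner 2 (fderiv ℝ x p v) (fderiv ℝ x p w) := by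
  have hV : Differentiable ℝ lorentzVeronese := by
    rw [differentiable_pi]
    intro i
    fin_cases i <;> simp [lorentzVeronese] <;> fun_prop
  have hxd : DifferentiableAt ℝ x p := by
    have h1 : DifferentiableAt ℝ (fun q => A.symm (lorentzVeronese (ψ q))) p :=
      ((LinearMap.toContinuousLinearMap A.symm.toLinearMap).differentiableAt).comp p
        ((hV _).comp p (hψ p hp))
    refine h1.congr_of_eventuallyEq ?_
    filter_upwards [hD.mem_nhds hp] with q hq
    rw [← hx q hq, A.symm_apply_apply]
  have hJ (v : E) : IsOpen {τ : ℝ | p + τ • v ∈ D} :=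
    hD.preimage (by fun_prop : Continuous fun τ : ℝ => p + τ • v)
  have hJ0 (v : E) : (0 : ℝ) ∈ {τ : ℝ | p + τ • v ∈ D} := by simpa using hp
  have dψ (v : E) : HasDerivAt (fun τ : ℝ => ψ (p + τ • v)) (fderiv ℝ ψ p v) 0 := by
    refine HasFDerivAt.comp_hasDerivAt (0 : ℝ) ?_ (HasDerivAt.line p v)
    simpa using (hψ p hp).hasFDerivAt
  have dx (v : E) : HasDerivAt (fun τ : ℝ => x (p + τ • v)) (fderiv ℝ x p v) 0 := by
    refine HasFDerivAt.comp_hasDerivAt (0 : ℝ) ?_ (HasDerivAt.line p v)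
    simpa using hxd.hasFDerivAt
  -- Tangency to the sphere removes every term of the polarised inner product except ⟨ψ, ψ⟩⟨dψ v, dψ
  -- w⟩ / 12, and 4 · 3 / 12 = 1.
  have tang (v : E) : pseudoInner 1 (ψ p) (fderiv ℝ ψ p v) = 0 := by
    have := HasDerivAt.eq_of_eqOn (hJ v) (hJ0 v) (fun τ hτ => hS _ hτ)
      ((dψ v).pseudoInner 1 (dψ v)) (hasDerivAt_const _ _)
    rw [pseudoInner_comm] at this
    simp only [zero_smul, add_zero] at this
    linarith
  have hAx (v : E) : A (fderiv ℝ x p v) = (2 : ℝ) • veronesePolar (ψ p) (fderiv ℝ ψ p v) := by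
    rw [HasDerivAt.eq_of_eqOn (hJ v) (hJ0 v) (fun τ hτ => hx _ hτ) (A.hasDerivAt_comp (dx v))
      (by simpa only [veronesePolar_self] using (dψ v).veronesePolar (dψ v)),
      veronesePolar_comm (fderiv ℝ ψ p v)]
    simp only [zero_smul, add_zero]
    module
  rw [← hA, hAx, hAx, pseudoInner_smul_left, pseudoInner_smul_right, pseudoInner_veronesePolar,
    hS p hp, tang v, tang w]
  ring

/-- The cone over the image of the ruled parametrisation is open. -/
lemma isOpen_cone_ruledMap {I : Set ℝ} (hI : IsOpen I) {β : ℝ → Fin 3 → ℝ}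
    (hβ : ContDiffOn ℝ ∞ β I)
    (h3 : ∀ t ∈ I, IsNullTriple (β t) (deriv β t) (iteratedDeriv 2 β t)) :
    IsOpen ((fun y : ℝ × ℝ × ℝ => y.1 • ruledMap β y.2) '' (Ioi 0 ×ˢ (univ ×ˢ I))) := by
  have hD : IsOpen ((Ioi 0 : Set ℝ) ×ˢ ((univ : Set ℝ) ×ˢ I)) :=
    isOpen_Ioi.prod (isOpen_univ.prod hI)
  set Φ : ℝ × ℝ × ℝ → Fin 3 → ℝ := fun y => y.1 • ruledMap β y.2 with hΦ
  have hs : ContDiffOn ℝ ∞ Φ (Ioi 0 ×ˢ (univ ×ˢ I)) :=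
    contDiff_fst.contDiffOn.smul
      ((contDiffOn_ruledMap hI hβ).comp contDiff_snd.contDiffOn fun y hy => hy.2)
  rw [isOpen_iff_mem_nhds]
  rintro _ ⟨y, hy, rfl⟩
  have hst := (hs.contDiffAt (hD.mem_nhds hy)).hasStrictFDerivAt (by simp)
  -- A strictly differentiable map with surjective derivative is locally open; the three partial
  -- derivatives span β, β', β''.
  suffices hsurj : (fderiv ℝ Φ y).range = ⊤ by
    rw [← hst.map_nhds_eq_of_surj hsurj]
    exact Filter.image_mem_map (hD.mem_nhds hy)
  have dΦ (v : ℝ × ℝ × ℝ) : HasDerivAt (fun τ : ℝ => Φ (y + τ • v)) (fderiv ℝ Φ y v) 0 := by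
    have h : HasFDerivAt Φ (fderiv ℝ Φ y) (y + (0 : ℝ) • v) := by
      simpa only [zero_smul, add_zero] using hst.hasFDerivAt
    exact h.comp_hasDerivAt (0 : ℝ) (HasDerivAt.line y v)
  obtain ⟨r, s, t⟩ := y
  obtain ⟨hr : 0 < r, -, ht : t ∈ I⟩ := hy
  have b0 := hβ.hasDerivAt_deriv hI ht
  have b1 : HasDerivAt (deriv β) (iteratedDeriv 2 β t) t := by
    simpa [iteratedDeriv_one] using hβ.hasDerivAt_iteratedDeriv hI 1 ht
  have c0 : HasDerivAt (fun τ : ℝ => β (t + τ)) (deriv β t) 0 :=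
    HasDerivAt.comp_const_add t 0 (by simpa only [add_zero] using b0)
  have c1 : HasDerivAt (fun τ : ℝ => deriv β (t + τ)) (iteratedDeriv 2 β t) 0 :=
    HasDerivAt.comp_const_add t 0 (by simpa only [add_zero] using b1)
  have e0 : fderiv ℝ Φ (r, s, t) (1, 0, 0) = s • β t + (3 : ℝ) • deriv β t := by
    refine (dΦ _).unique ?_
    simpa [hΦ, ruledMap] using (((hasDerivAt_id (0 : ℝ)).const_add r).smul_const
      (s • β t + (3 : ℝ) • deriv β t))
  have e1 : fderiv ℝ Φ (r, s, t) (0, 1, 0) = r • β t := by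
    refine (dΦ _).unique ?_
    simpa [hΦ, ruledMap] using ((((hasDerivAt_id (0 : ℝ)).const_add s).smul_const
      (β t)).add_const ((3 : ℝ) • deriv β t)).fun_const_smul r
  have e2 : fderiv ℝ Φ (r, s, t) (0, 0, 1)
      = r • (s • deriv β t + (3 : ℝ) • iteratedDeriv 2 β t) := by
    refine (dΦ _).unique ?_
    simpa [hΦ, ruledMap] using ((c0.fun_const_smul s).fun_add (c1.fun_const_smul (3 : ℝ))).fun_const_smul r
  have m0 : β t ∈ (fderiv ℝ Φ (r, s, t)).range := by
    refine ⟨r⁻¹ • (0, 1, 0), ?_⟩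
    rw [ContinuousLinearMap.coe_coe, map_smul, e1, smul_smul, inv_mul_cancel₀ hr.ne', one_smul]
  have m1 : deriv β t ∈ (fderiv ℝ Φ (r, s, t)).range := by
    have h : deriv β t = (1 / 3 : ℝ) • (fderiv ℝ Φ (r, s, t) (1, 0, 0) + (-s) • β t) := by
      rw [e0]
      module
    rw [h]
    exact Submodule.smul_mem _ _ (Submodule.add_mem _ ⟨_, rfl⟩ (Submodule.smul_mem _ _ m0))
  have m2 : iteratedDeriv 2 β t ∈ (fderiv ℝ Φ (r, s, t)).range := by
    have h : iteratedDeriv 2 β t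
        = (1 / 3 : ℝ) • (r⁻¹ • fderiv ℝ Φ (r, s, t) (0, 0, 1) + (-s) • deriv β t) := by
      rw [e2, smul_smul, inv_mul_cancel₀ hr.ne', one_smul]
      module
    rw [h]
    exact Submodule.smul_mem _ _ (Submodule.add_mem _ (Submodule.smul_mem _ _ ⟨_, rfl⟩)
      (Submodule.smul_mem _ _ m1))
  rw [eq_top_iff]
  intro v _
  rw [(h3 t ht).expansion v]
  exact Submodule.add_mem _ (Submodule.add_mem _ (Submodule.smul_mem _ _ m0)
    (Submodule.smul_mem _ _ m1)) (Submodule.smul_mem _ _ m2)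

end

/-! ### Assembly of the congruence. -/

theorem proposition3p7 (I : Set ℝ) (hI : IsOpen I) (hIc : I.OrdConnected)
    (α : ℝ → Fin 5 → ℝ) (hα : ContDiffOn ℝ ∞ α I)
    (hcone : ∀ t ∈ I, α t ∈ lightCone 5 2)
    (hnull : ∀ t ∈ I, pseudoInner 2 (deriv α t) (deriv α t) = 0)
    (hnorm : ∀ t ∈ I, pseudoInner 2 (iteratedDeriv 2 α t) (iteratedDeriv 2 α t) = 4 / 9)
    (hode : ∀ t ∈ I, 27 / 40 * iteratedDeriv 2 (etaFun α) t - 5103 / 1600 * etaFun α t ^ 2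
      + 27 / 16 * xiFun α t = 0) :
    IsCongruentToLorentzVeronese (univ ×ˢ I) (surfaceOf α) := by
  rcases I.eq_empty_or_nonempty with rfl | ⟨t₀, ht₀⟩
  · exact ⟨LinearEquiv.refl ℝ _, fun _ => 0, ∅, by simp⟩
  obtain ⟨X₁, X₂, X₃, X₄, κ, hX⟩ := exists_nullFrame hI hα hcone hnull hnorm hode
  obtain ⟨A, β, hA, hβ, h⟩ := exists_null_lift hI hIc hα hX ht₀
  have hT {t : ℝ} (ht : t ∈ I) := null_lift_triple hI hα hβ hnorm hA (fun t ht => (h t ht).1)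
    (fun t ht => (h t ht).2.1) (fun t ht => (h t ht).2.2) ht
  have hD : IsOpen ((univ : Set ℝ) ×ˢ I) := isOpen_univ.prod hI
  have hψ := contDiffOn_ruledMap hI hβ
  have hS : ∀ p ∈ (univ : Set ℝ) ×ˢ I, pseudoInner 1 (ruledMap β p) (ruledMap β p) = 3 :=
    fun p hp => ruledMap_mem_sphere (hT hp.2).1
  have hx : ∀ p ∈ (univ : Set ℝ) ×ˢ I, A (surfaceOf α p) = lorentzVeronese (ruledMap β p) :=
    fun p hp => isometry_surfaceOf_eq hI hα hβ (fun t ht => (h t ht).2.2) hp.2 (hT hp.2).1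
      (hT hp.2).2
  -- The open set is the positive cone over the image; it meets the sphere only at scale r = 1,
  -- since 3 r² = 3 and r > 0.
  refine ⟨A, ruledMap β, _, hA, hψ, fun p hp v w => pseudoInner_fderiv_eq hD hA
    (fun q hq => (hψ.contDiffAt (hD.mem_nhds hq)).differentiableAt (by simp)) hS hx hp v w,
    isOpen_cone_ruledMap hI hβ fun t ht => (hT ht).1, ?_, hx⟩
  ext y
  constructor
  · rintro ⟨p, hp, rfl⟩
    refine ⟨?_, (1, p), ⟨zero_lt_one' ℝ, hp⟩, one_smul _ _⟩
    simp [pseudoSphere, hS p hp]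
  · rintro ⟨hy, ⟨r, p⟩, ⟨hr : 0 < r, hp⟩, rfl⟩
    have h1 : r * (r * 3) = 3 := by
      simpa [pseudoSphere, pseudoInner_smul_left, pseudoInner_smul_right, hS p hp] using hy
    have h2 : r = 1 := by nlinarith
    exact ⟨p, hp, by simp [h2]⟩
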